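/- Let $\mathbb{D}$ be the open unit disc and $\mathbb{T}$ the unit circle of $\mathbb{C}$, and let $H(\mathbb{D})$ be the space of holomorphic functions on $\mathbb{D}$ with the topology of uniform convergence on compact subsets of $\mathbb{D}$. For a sequence $\varrho=(r_n)_{n\in\mathbb{N}}$ in $[0,1)$ tending to $1$, let $\mathcal{U}_A(\mathbb{D},\varrho)$ be the set of all $f\in H(\mathbb{D})$ such that, for every compact set $K\subset\mathbb{T}$ with $K\neq\mathbb{T}$, the set of functions $\{K\ni\zeta\mapsto f(r_n\zeta) : n\in\mathbb{N}\}$ is dense in the space $\mathcal{C}(K)$ of continuous complex-valued functions on $K$ with the uniform topology. Let $\Lambda\subset\mathbb{R}$ be a $\sigma$-compact set (a countable union of compact sets), and for each $\lambda\in\Lambda$ let $\varrho(\lambda)=(r_n(\lambda))_{n\in\mathbb{N}}$ be an increasing (not necessarily strictly) sequence in $[0,1)$ with $r_n(\lambda)\to 1$ as $n\to\infty$. Assume that for every $n\in\mathbb{N}$ the map $\lambda\mapsto r_n(\lambda)$ is continuous on $\Lambda$. Then $$\bigcap_{\lambda\in\Lambda}\mathcal{U}_A(\mathbb{D},\varrho(\lambda))$$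 is a dense $G_\delta$ subset of $H(\mathbb{D})$ (the intersection being $H(\mathbb{D})$ if $\Lambda=\emptyset$). -/

import Mathlib

/-- The open unit disc of the complex plane, as a subset of `ℂ`. -/
abbrev openDisc : Set ℂ := Metric.ball (0 : ℂ) 1

/-- The space `H(𝔻)` of holomorphic functions on the open unit disc, as a set of continuous
functions on the disc. `C(openDisc, ℂ)` carries the compact-open topology, that is, the topology of
uniform convergence on compact subsets of the disc; `H(𝔻)`, used as a type, carries the induced
topology. -/
def HolDisc : Set C(openDisc, ℂ) :=
  {f | ∃ F : ℂ → ℂ, DifferentiableOn ℂ F openDisc ∧ ∀ z : openDisc, f z = F z}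

/-- For `r ∈ [0, 1)` and `ζ` on the unit circle, the point `r ζ` of the open unit disc. -/
def radialPoint (r : Set.Ico (0 : ℝ) 1) (ζ : Circle) : openDisc :=
  ⟨(r : ℂ) * (ζ : ℂ), by
    have h0 : (0 : ℝ) ≤ r := r.2.1
    have h1 : (r : ℝ) < 1 := r.2.2
    have h2 : ‖(ζ : ℂ)‖ = 1 := Circle.norm_coe ζ
    rw [mem_ball_zero_iff, norm_mul, h2, mul_one, Complex.norm_real, Real.norm_of_nonneg h0]
    exact h1⟩

theorem continuous_radialPoint (r : Set.Ico (0 : ℝ) 1) : Continuous (radialPoint r) := by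
  unfold radialPoint
  fun_prop

/-- The restriction to the unit circle of the dilation `f_r : z ↦ f (r z)`. -/
noncomputable def dilation (f : HolDisc) (r : Set.Ico (0 : ℝ) 1) : C(Circle, ℂ) :=
  ⟨fun ζ => f.1 (radialPoint r ζ), f.1.continuous.comp (continuous_radialPoint r)⟩

/-- The set `𝒰_A(𝔻, ϱ)` of `ϱ`-Abel universal functions: those `f ∈ H(𝔻)` such that, for every
compact subset `K` of the unit circle different from the circle, the restrictions to `K` of the
dilations `f_{r_n}` form a dense subset of the space `C(K, ℂ)` with its uniform topology (the
compact-open topology of `C(K, ℂ)`, as `K` is compact). -/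
def abelUniversal (ϱ : ℕ → Set.Ico (0 : ℝ) 1) : Set HolDisc :=
  {f | ∀ K : Set Circle, IsCompact K → K ≠ Set.univ →
    Dense (Set.range fun n : ℕ => (dilation f (ϱ n)).restrict K)}

/-! This is a Baire category argument. A countable family of conditions suffices: `Λ` is a countable
union of compact pieces, every proper compact subset of the circle misses a basic open set `U`, and
each `C(Uᶜ, ℂ)` is second countable. Each condition defines a `dilationHits` set, which is open
because the parameter ranges over a compact set.

Density rests on `exists_polynomial_near`: a polynomial can be close to a holomorphic function on a
smaller disc and, independently, close to a prescribed continuous function on `K`. Its dilations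
stay in the target for all radii above some `R < 1`, and by a Dini-type argument one index `n` has
`r_n > R` on the whole compact piece.

The approximation is done in a Banach algebra. In the closed algebra generated by the coordinate,
passing from the ambient algebra can only fill bounded holes of the spectrum. As `K` omits a point,
the annulus between the disc and the circle lies in no hole. The resulting inverses produce `(0,
ζ⁻¹)`, and Stone–Weierstrass then gives every `(0, φ)`. -/

open Filter Topology

/-! ### Polynomial approximation on a disc and a proper subset of the circle -/

/-- The pair of coordinate functions on a closed disc and on a set of unimodular numbers. -/
def discArcCoord (ρ : ℝ) (K : Set Circle) : C(Metric.closedBall (0 : ℂ) ρ, ℂ) × C(K, ℂ) :=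
  (⟨fun z => (z : ℂ), by fun_prop⟩, ⟨fun ζ => ((ζ : Circle) : ℂ), by fun_prop⟩)

@[simp] theorem discArcCoord_fst (ρ : ℝ) (K : Set Circle) (z : Metric.closedBall (0 : ℂ) ρ) :
    (discArcCoord ρ K).1 z = z := rfl

@[simp] theorem discArcCoord_snd (ρ : ℝ) (K : Set Circle) (ζ : K) :
    (discArcCoord ρ K).2 ζ = ((ζ : Circle) : ℂ) := rfl

theorem notMem_spectrum_discArcCoord {ρ : ℝ} {K : Set Circle} {w : ℂ} (hρ : ρ < ‖w‖)
    (hK : ∀ ζ ∈ K, (ζ : ℂ) ≠ w) : w ∉ spectrum ℂ (discArcCoord ρ K) := by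
  rw [spectrum.mem_iff, not_not, Prod.isUnit_iff]
  constructor
  · rw [ContinuousMap.isUnit_iff_forall_ne_zero]
    intro z hz
    have h1 : w - (z : ℂ) = 0 := hz
    have h2 : ‖(z : ℂ)‖ ≤ ρ := mem_closedBall_zero_iff.1 z.2
    rw [← sub_eq_zero.1 h1] at h2
    linarith
  · rw [ContinuousMap.isUnit_iff_forall_ne_zero]
    intro z hz
    have h1 : w - ((z : Circle) : ℂ) = 0 := hz
    exact hK z z.2 (sub_eq_zero.1 h1).symm

theorem isPreconnected_sphere_union_ray (c : Circle) {t : ℝ} (ht : 0 < t) :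
    IsPreconnected (Metric.sphere (0 : ℂ) t ∪ (fun s : ℝ => (s : ℂ) * c) '' Set.Ici t) := by
  refine IsPreconnected.union ((t : ℂ) * c) ?_ ⟨t, Set.mem_Ici.2 le_rfl, rfl⟩ ?_ ?_
  · simp [abs_of_pos ht, Circle.norm_coe]
  · exact isPreconnected_sphere (by rw [Complex.rank_real_complex]; norm_num) _ _
  · exact isPreconnected_Ici.image _ (by fun_prop)

/-- The circle through `w` lies strictly between the disc and the unit circle, and the ray through a
point `c ∉ K` meets the unit circle only at `c`. Their union thus joins `w` to infinity off the
spectrum. -/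
theorem not_isBounded_connectedComponentIn_spectrum {ρ : ℝ} (hρ : 0 ≤ ρ) {K : Set Circle}
    (hK : K ≠ Set.univ) {w : ℂ} (h1 : ρ < ‖w‖) (h2 : ‖w‖ < 1) :
    ¬ Bornology.IsBounded (connectedComponentIn (spectrum ℂ (discArcCoord ρ K))ᶜ w) := by
  obtain ⟨c, hc⟩ := (Set.ne_univ_iff_exists_notMem K).1 hK
  have hpos : 0 < ‖w‖ := hρ.trans_lt h1
  intro hb
  have hsub := (isPreconnected_sphere_union_ray c hpos).subset_connectedComponentIn
    (F := (spectrum ℂ (discArcCoord ρ K))ᶜ) (x := w) (Or.inl (by simp)) (by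
      rintro z (hz | ⟨s, hs, rfl⟩)
      · have hz' : ‖z‖ = ‖w‖ := by simpa using hz
        refine notMem_spectrum_discArcCoord (by linarith) fun ζ _ h => ?_
        rw [← h, Circle.norm_coe] at hz'
        linarith
      · have hs' : ‖w‖ ≤ s := hs
        have hs0 : 0 < s := hpos.trans_le hs'
        refine notMem_spectrum_discArcCoord (by simp [abs_of_pos hs0, Circle.norm_coe]; linarith) fun ζ hζ h => ?_
        have hs1 : s = 1 := by simpa [abs_of_pos hs0, Circle.norm_coe] using (congrArg norm h).symm
        simp only [hs1, Complex.ofReal_one, one_mul] at h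
        exact hc (Circle.ext h ▸ hζ))
  obtain ⟨R, hR⟩ := (hb.subset hsub).exists_norm_le
  have := hR _ (Or.inr ⟨max ‖w‖ (R + 1), Set.mem_Ici.2 (le_max_left _ _), rfl⟩)
  have h0 : 0 < max ‖w‖ (R + 1) := hpos.trans_le (le_max_left _ _)
  simp only [norm_mul, Circle.norm_coe, mul_one, Complex.norm_real, Real.norm_of_nonneg h0.le] at this
  linarith [le_max_right ‖w‖ (R + 1)]

/-- The closure of the polynomials in the continuous functions on a disc and an arc. -/
noncomputable abbrev polynomialClosure (ρ : ℝ) (K : Set Circle) [CompactSpace K] :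
    Subalgebra ℂ (C(Metric.closedBall (0 : ℂ) ρ, ℂ) × C(K, ℂ)) :=
  Algebra.elemental ℂ (discArcCoord ρ K)

theorem exists_mul_pow_sub_eq_one {ρ t : ℝ} (hρ : 0 ≤ ρ) (h1 : ρ < t) (h2 : t < 1) {K : Set Circle}
    [CompactSpace K] (hK : K ≠ Set.univ) {N : ℕ} (hN : 0 < N) :
    ∃ b ∈ polynomialClosure ρ K,
      (discArcCoord ρ K ^ N - algebraMap ℂ _ ((t : ℂ) ^ N)) * b = 1 := by
  have ht : 0 < t := hρ.trans_lt h1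
  let x : polynomialClosure ρ K := ⟨discArcCoord ρ K, Algebra.elemental.self_mem ℂ _⟩
  have : IsClosed (polynomialClosure ρ K : Set (C(Metric.closedBall (0 : ℂ) ρ, ℂ) × C(K, ℂ))) :=
    Algebra.elemental.isClosed ℂ _
  have hsp : (t : ℂ) ^ N ∉ spectrum ℂ (x ^ N) := by
    -- By spectral mapping, a failure would put some `w` with `‖w‖ = t` in the spectrum relative to
    -- the subalgebra, hence in a bounded component.
    rw [spectrum.map_pow_of_pos x hN]
    rintro ⟨w, hw, hwt⟩
    have hnorm : ‖w‖ = t := by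
      have := congrArg norm hwt
      simp only [norm_pow, Complex.norm_real, Real.norm_of_nonneg ht.le] at this
      exact (pow_left_inj₀ (norm_nonneg _) ht.le hN.ne').1 this
    exact not_isBounded_connectedComponentIn_spectrum hρ hK (hnorm ▸ h1) (hnorm ▸ h2)
      (Subalgebra.spectrum_isBounded_connectedComponentIn (polynomialClosure ρ K) x hw)
  rw [spectrum.mem_iff, not_not] at hsp
  obtain ⟨b, hb⟩ := hsp.exists_right_inv
  refine ⟨-b, (polynomialClosure ρ K).neg_mem b.2, ?_⟩
  have := congrArg (Subtype.val) hb
  rw [mul_neg, ← neg_mul, neg_sub]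
  exact this

/-- The function equal to `0` on the disc and to `ζ ↦ ζ⁻¹` on the arc. -/
theorem zero_conj_mem_polynomialClosure {ρ : ℝ} (hρ : 0 < ρ) (hρ1 : ρ < 1) {K : Set Circle}
    [CompactSpace K] (hK : K ≠ Set.univ) :
    ((0, star (discArcCoord ρ K).2) : C(Metric.closedBall (0 : ℂ) ρ, ℂ) × C(K, ℂ)) ∈
      polynomialClosure ρ K := by
  obtain ⟨t, h1, h2⟩ := exists_between hρ1
  have ht : 0 < t := hρ.trans h1
  choose b hbmem hb using fun N : ℕ =>
    exists_mul_pow_sub_eq_one hρ.le h1 h2 hK (Nat.succ_pos N)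
  have hA : IsClosed (polynomialClosure ρ K : Set (C(Metric.closedBall (0 : ℂ) ρ, ℂ) × C(K, ℂ))) :=
    Algebra.elemental.isClosed ℂ _
  have hpt : Tendsto (fun n : ℕ => t ^ (n + 1)) atTop (𝓝 0) :=
    (tendsto_pow_atTop_nhds_zero_of_lt_one ht.le h2).comp (tendsto_add_atTop_nat 1)
  have hb1 : ∀ N (z : Metric.closedBall (0 : ℂ) ρ),
      ((z : ℂ) ^ (N + 1) - (t : ℂ) ^ (N + 1)) * (b N).1 z = 1 := fun N z =>
    congrArg (fun g => g.1 z) (hb N)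
  have hb2 : ∀ N (ζ : K),
      (((ζ : Circle) : ℂ) ^ (N + 1) - (t : ℂ) ^ (N + 1)) * (b N).2 ζ = 1 := fun N z =>
    congrArg (fun g => g.2 z) (hb N)
  -- Here `b N` inverts `x ^ (N + 1) - t ^ (N + 1)`. The exponent `N`, one less, makes the limit
  -- `ζ⁻¹` on `K`, where `t ^ (N + 1)` is negligible; on the disc `ρ < t` forces the limit `0`.
  refine hA.mem_of_tendsto (f := fun N : ℕ => discArcCoord ρ K ^ N * b N) (b := atTop) ?_
    (.of_forall fun N => (polynomialClosure ρ K).mul_mem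
      ((polynomialClosure ρ K).pow_mem (Algebra.elemental.self_mem ℂ _) _) (hbmem N))
  refine Tendsto.prodMk_nhds (mx := fun N : ℕ => (discArcCoord ρ K ^ N * b N).1)
    (my := fun N : ℕ => (discArcCoord ρ K ^ N * b N).2) ?_ ?_
  · rw [tendsto_iff_norm_sub_tendsto_zero]
    have hq : Tendsto (fun n : ℕ => (ρ⁻¹ * (ρ / t) ^ (n + 1)) / (1 - (ρ / t) ^ (n + 1))) atTop
        (𝓝 ((ρ⁻¹ * 0) / (1 - 0))) := by
      have : Tendsto (fun n : ℕ => (ρ / t) ^ (n + 1)) atTop (𝓝 0) :=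
        (tendsto_pow_atTop_nhds_zero_of_lt_one (by positivity) ((div_lt_one ht).2 h1)).comp
          (tendsto_add_atTop_nat 1)
      exact (this.const_mul _).div (tendsto_const_nhds.sub this) (by norm_num)
    simp only [mul_zero, zero_div] at hq
    refine squeeze_zero (fun _ => norm_nonneg _) (fun N => ?_) hq
    have hlt : ρ ^ (N + 1) < t ^ (N + 1) := pow_lt_pow_left₀ h1 hρ.le (Nat.succ_ne_zero N)
    have hq1 : (ρ / t) ^ (N + 1) < 1 := by rw [div_pow]; exact (div_lt_one (by positivity)).2 hlt
    have hq0 : 0 < 1 - (ρ / t) ^ (N + 1) := by linarith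
    rw [ContinuousMap.norm_le _ (by positivity)]
    intro z
    have hz : ‖(z : ℂ)‖ ≤ ρ := mem_closedBall_zero_iff.1 z.2
    have hzN : ‖(z : ℂ)‖ ^ (N + 1) ≤ ρ ^ (N + 1) := pow_le_pow_left₀ (norm_nonneg _) hz _
    have e : ((discArcCoord ρ K ^ N * b N).1 - 0) z = (z : ℂ) ^ N * (b N).1 z := by
      simp
    rw [e, norm_mul, norm_pow]
    have hd : t ^ (N + 1) - ρ ^ (N + 1) ≤ ‖(z : ℂ) ^ (N + 1) - (t : ℂ) ^ (N + 1)‖ := by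
      have := norm_sub_norm_le ((t : ℂ) ^ (N + 1)) ((z : ℂ) ^ (N + 1))
      rw [norm_sub_rev] at this
      simp only [norm_pow, Complex.norm_real, Real.norm_of_nonneg ht.le] at this
      linarith
    have hbn : ‖(b N).1 z‖ ≤ 1 / (t ^ (N + 1) - ρ ^ (N + 1)) := by
      have hb1' := congrArg norm (hb1 N z)
      rw [norm_mul, norm_one] at hb1'
      rw [le_div_iff₀ (by linarith), mul_comm]
      refine le_trans ?_ hb1'.le
      gcongr
    calc ‖(z : ℂ)‖ ^ N * ‖(b N).1 z‖ ≤ ρ ^ N * (1 / (t ^ (N + 1) - ρ ^ (N + 1))) := by gcongr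
      _ = _ := by
        have : t ^ (N + 1) - ρ ^ (N + 1) ≠ 0 := by linarith
        rw [div_pow] at hq0 ⊢
        field_simp
        rw [pow_succ]
  · rw [tendsto_iff_norm_sub_tendsto_zero]
    have hq : Tendsto (fun n : ℕ => t ^ (n + 1) / (1 - t ^ (n + 1))) atTop
        (𝓝 (0 / (1 - 0))) := hpt.div (tendsto_const_nhds.sub hpt) (by norm_num)
    rw [zero_div] at hq
    refine squeeze_zero (fun _ => norm_nonneg _) (fun N => ?_) hq
    have hlt : t ^ (N + 1) < 1 := pow_lt_one₀ ht.le h2 (Nat.succ_ne_zero N)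
    have hq0 : 0 < 1 - t ^ (N + 1) := by linarith
    rw [ContinuousMap.norm_le _ (by positivity)]
    intro ζ
    have hζ : ((ζ : Circle) : ℂ) * star ((ζ : Circle) : ℂ) = 1 := by
      rw [Complex.star_def, Complex.mul_conj, Circle.normSq_coe, Complex.ofReal_one]
    have e : ((discArcCoord ρ K ^ N * b N).2 - star (discArcCoord ρ K).2) ζ =
        ((t : ℂ) ^ (N + 1) * star ((ζ : Circle) : ℂ)) * (b N).2 ζ := by
      have e1 : ((discArcCoord ρ K ^ N * b N).2 - star (discArcCoord ρ K).2) ζ =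
        ((ζ : Circle) : ℂ) ^ N * (b N).2 ζ - star ((ζ : Circle) : ℂ) := by simp
      rw [e1]
      linear_combination (star ((ζ : Circle) : ℂ)) * hb2 N ζ +
        (((ζ : Circle) : ℂ) ^ N * (b N).2 ζ) * (-hζ)
    have hd : 1 - t ^ (N + 1) ≤ ‖((ζ : Circle) : ℂ) ^ (N + 1) - (t : ℂ) ^ (N + 1)‖ := by
      have := norm_sub_norm_le (((ζ : Circle) : ℂ) ^ (N + 1)) ((t : ℂ) ^ (N + 1))
      simpa only [norm_pow, Complex.norm_real, Real.norm_of_nonneg ht.le, Circle.norm_coe,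
        one_pow] using this
    have hbn : ‖(b N).2 ζ‖ ≤ 1 / (1 - t ^ (N + 1)) := by
      have hb2' := congrArg norm (hb2 N ζ)
      rw [norm_mul, norm_one] at hb2'
      rw [le_div_iff₀ hq0, mul_comm]
      refine le_trans ?_ hb2'.le
      gcongr
    rw [e, norm_mul, norm_mul, norm_star, Circle.norm_coe, mul_one, norm_pow, Complex.norm_real,
      Real.norm_of_nonneg ht.le, div_eq_mul_one_div]
    gcongr

theorem zero_prod_mem_polynomialClosure {ρ : ℝ} (hρ : 0 < ρ) (hρ1 : ρ < 1) {K : Set Circle}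
    [CompactSpace K] (hK : K ≠ Set.univ) (φ : C(K, ℂ)) :
    ((0, φ) : C(Metric.closedBall (0 : ℂ) ρ, ℂ) × C(K, ℂ)) ∈ polynomialClosure ρ K := by
  set u := (discArcCoord ρ K).2
  have hu : u * star u = 1 := by
    ext ζ
    change ((ζ : Circle) : ℂ) * star ((ζ : Circle) : ℂ) = 1
    rw [Complex.star_def, Complex.mul_conj, Circle.normSq_coe, Complex.ofReal_one]
  have hstar := zero_conj_mem_polynomialClosure hρ hρ1 hK
  have hself := Algebra.elemental.self_mem ℂ (discArcCoord ρ K)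
  have hone : ((0, 1) : C(Metric.closedBall (0 : ℂ) ρ, ℂ) × C(K, ℂ)) ∈ polynomialClosure ρ K := by
    have := (polynomialClosure ρ K).mul_mem hself hstar
    rwa [Prod.mul_def, mul_zero, hu] at this
  have hid : ((0, u) : C(Metric.closedBall (0 : ℂ) ρ, ℂ) × C(K, ℂ)) ∈ polynomialClosure ρ K := by
    have := (polynomialClosure ρ K).mul_mem hself hone
    rwa [Prod.mul_def, mul_zero, mul_one] at this
  have hA : IsClosed (polynomialClosure ρ K : Set (C(Metric.closedBall (0 : ℂ) ρ, ℂ) × C(K, ℂ))) :=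
    Algebra.elemental.isClosed ℂ _
  let T : StarSubalgebra ℂ C(K, ℂ) :=
    -- The polynomial closure is not known to be stable under `star`, so both conditions are
    -- imposed.
    { carrier := {φ | (0, φ) ∈ polynomialClosure ρ K ∧ (0, star φ) ∈ polynomialClosure ρ K}
      mul_mem' := by
        rintro a b ⟨ha, ha'⟩ ⟨hb, hb'⟩
        refine ⟨?_, ?_⟩
        · simpa using (polynomialClosure ρ K).mul_mem ha hb
        · simpa [mul_comm] using (polynomialClosure ρ K).mul_mem hb' ha'
      add_mem' := by
        rintro a b ⟨ha, ha'⟩ ⟨hb, hb'⟩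
        refine ⟨?_, ?_⟩
        · simpa using (polynomialClosure ρ K).add_mem ha hb
        · simpa using (polynomialClosure ρ K).add_mem ha' hb'
      algebraMap_mem' := by
        intro r
        rw [Set.mem_ofPred_eq, Algebra.algebraMap_eq_smul_one, star_smul, star_one]
        refine ⟨?_, ?_⟩
        · simpa using (polynomialClosure ρ K).smul_mem hone r
        · simpa using (polynomialClosure ρ K).smul_mem hone (star r)
      star_mem' := by
        rintro a ⟨ha, ha'⟩
        exact ⟨ha', by rwa [star_star]⟩ }
  have hT : T.topologicalClosure = ⊤ :=
    ContinuousMap.starSubalgebra_topologicalClosure_eq_top_of_separatesPoints T (by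
      intro x y hxy
      refine ⟨u, ⟨u, ⟨hid, hstar⟩, rfl⟩, fun h => hxy (Subtype.ext (Circle.ext h))⟩)
  have hφ : φ ∈ T.topologicalClosure := hT ▸ StarSubalgebra.mem_top
  have hcl : closure (T : Set C(K, ℂ)) ⊆ {φ | (0, φ) ∈ polynomialClosure ρ K} :=
    closure_minimal (fun a ha => ha.1) (hA.preimage (by fun_prop))
  exact hcl hφ

theorem exists_polynomial_of_mem_polynomialClosure {ρ : ℝ} {K : Set Circle} [CompactSpace K]
    {g : C(Metric.closedBall (0 : ℂ) ρ, ℂ) × C(K, ℂ)} (hg : g ∈ polynomialClosure ρ K)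
    {s : Set (C(Metric.closedBall (0 : ℂ) ρ, ℂ) × C(K, ℂ))} (hs : s ∈ 𝓝 g) :
    ∃ p : Polynomial ℂ, Polynomial.aeval (discArcCoord ρ K) p ∈ s := by
  obtain ⟨a, has, ha⟩ := mem_closure_iff_nhds.1 hg s hs
  rw [SetLike.mem_coe, Algebra.adjoin_singleton_eq_range_aeval] at ha
  obtain ⟨p, rfl⟩ := ha
  exact ⟨p, has⟩

theorem aeval_discArcCoord_fst (ρ : ℝ) (K : Set Circle) (p : Polynomial ℂ)
    (z : Metric.closedBall (0 : ℂ) ρ) :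
    (Polynomial.aeval (discArcCoord ρ K) p).1 z = p.eval (z : ℂ) := by
  induction p using Polynomial.induction_on' with
  | add p q hp hq => simp [hp, hq]
  | monomial n a => simp [Polynomial.aeval_monomial, Algebra.algebraMap_eq_smul_one]

theorem aeval_discArcCoord_snd (ρ : ℝ) (K : Set Circle) (p : Polynomial ℂ) (ζ : K) :
    (Polynomial.aeval (discArcCoord ρ K) p).2 ζ = p.eval ((ζ : Circle) : ℂ) := by
  induction p using Polynomial.induction_on' with
  | add p q hp hq => simp [hp, hq]
  | monomial n a => simp [Polynomial.aeval_monomial, Algebra.algebraMap_eq_smul_one]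

theorem exists_polynomial_tendstoUniformlyOn_closedBall {F : ℂ → ℂ}
    (hF : DifferentiableOn ℂ F openDisc) {ρ : ℝ} (hρ : 0 < ρ) (hρ1 : ρ < 1) :
    ∃ q : ℕ → Polynomial ℂ,
      TendstoUniformlyOn (fun n z => (q n).eval z) F atTop (Metric.closedBall 0 ρ) := by
  obtain ⟨r, h1, h2⟩ := exists_between hρ1
  obtain ⟨t, h3, h4⟩ := exists_between h1
  lift r to NNReal using (hρ.trans h1).le
  lift t to NNReal using (hρ.trans h3).le
  have hd : DifferentiableOn ℂ F (Metric.closedBall 0 r) :=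
    hF.mono (Metric.closedBall_subset_ball h2)
  have hs := hd.hasFPowerSeriesOnBall (by exact_mod_cast hρ.trans h1)
  set P := cauchyPowerSeries F 0 r
  refine ⟨fun n => ∑ k ∈ Finset.range n, Polynomial.C (P.coeff k) * Polynomial.X ^ k, ?_⟩
  have hu := hs.tendstoUniformlyOn (r' := t) (by exact_mod_cast h4)
  refine ((hu.mono (s' := Metric.closedBall 0 ρ) ?_).congr (.of_forall fun n z _ => ?_)).congr_right
    fun z _ => ?_
  · exact Metric.closedBall_subset_ball h3
  · simp only [FormalMultilinearSeries.partialSum, FormalMultilinearSeries.apply_eq_pow_smul_coeff,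
      Polynomial.eval_finsetSum, Polynomial.eval_mul, Polynomial.eval_C, Polynomial.eval_pow,
      Polynomial.eval_X, smul_eq_mul, mul_comm]
  · simp

theorem exists_polynomial_near {F : ℂ → ℂ} (hF : DifferentiableOn ℂ F openDisc) {ρ ε : ℝ}
    (hρ : 0 < ρ) (hρ1 : ρ < 1) (hε : 0 < ε) {K : Set Circle} [CompactSpace K]
    (hK : K ≠ Set.univ) {V : Set C(K, ℂ)} (hV : IsOpen V) (hVne : V.Nonempty) :
    ∃ p : Polynomial ℂ, (∀ z ∈ Metric.closedBall (0 : ℂ) ρ, ‖p.eval z - F z‖ < ε) ∧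
      (⟨fun ζ => p.eval ((ζ : Circle) : ℂ), by fun_prop⟩ : C(K, ℂ)) ∈ V := by
  obtain ⟨φ, hφ⟩ := hVne
  have hcont : Continuous fun z : Metric.closedBall (0 : ℂ) ρ => F z :=
    continuousOn_iff_continuous_domRestrict.1
      (hF.continuousOn.mono (Metric.closedBall_subset_ball hρ1))
  let G : C(Metric.closedBall (0 : ℂ) ρ, ℂ) := ⟨_, hcont⟩
  obtain ⟨q, hq⟩ := exists_polynomial_tendstoUniformlyOn_closedBall hF hρ hρ1
  have hA : IsClosed (polynomialClosure ρ K : Set (C(Metric.closedBall (0 : ℂ) ρ, ℂ) × C(K, ℂ))) :=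
    Algebra.elemental.isClosed ℂ _
  -- Taylor polynomials handle the disc; adding `(0, φ - q n)` corrects their values on `K` without
  -- disturbing the disc.
  have hmem : (G, φ) ∈ polynomialClosure ρ K := by
    refine hA.mem_of_tendsto (b := atTop)
      (f := fun n => ((Polynomial.aeval (discArcCoord ρ K) (q n)).1, φ)) ?_ (.of_forall fun n => ?_)
    · refine Tendsto.prodMk_nhds ?_ tendsto_const_nhds
      rw [ContinuousMap.tendsto_iff_tendstoUniformly]
      have hu := tendstoUniformlyOn_iff_tendstoUniformly_comp_coe.1 hq
      convert hu using 1
      · ext n z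
        exact aeval_discArcCoord_fst ρ K (q n) z
      · rfl
    · have h1 : Polynomial.aeval (discArcCoord ρ K) (q n) ∈ polynomialClosure ρ K :=
        subset_closure (Polynomial.aeval_mem_adjoin_singleton ℂ _)
      have h2 := zero_prod_mem_polynomialClosure hρ hρ1 hK
        (φ - (Polynomial.aeval (discArcCoord ρ K) (q n)).2)
      have h3 := (polynomialClosure ρ K).add_mem h1 h2
      rwa [Prod.add_def, add_zero, add_sub_cancel] at h3
  obtain ⟨p, hp⟩ := exists_polynomial_of_mem_polynomialClosure hmem
    (prod_mem_nhds (Metric.ball_mem_nhds G hε) (hV.mem_nhds hφ))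
  refine ⟨p, fun z hz => ?_, ?_⟩
  · have h1 := (ContinuousMap.dist_lt_iff hε).1 (Metric.mem_ball.1 hp.1) ⟨z, hz⟩
    rwa [aeval_discArcCoord_fst, dist_eq_norm] at h1
  · convert hp.2 using 1
    ext ζ
    exact (aeval_discArcCoord_snd ρ K p ζ).symm

/-! ### Polynomials in `H(𝔻)` and the topology of `H(𝔻)` -/

/-- A polynomial as an element of `H(𝔻)`. -/
noncomputable def polynomialHolDisc (p : Polynomial ℂ) : HolDisc :=
  ⟨⟨fun z => p.eval (z : ℂ), by fun_prop⟩, fun z => p.eval z, p.differentiable.differentiableOn,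
    fun _ => rfl⟩

/-- A polynomial is continuous across the unit circle, so its dilations depend continuously on the
radius up to and including `r = 1`. -/
theorem exists_radius_dilation_polynomial_mem (p : Polynomial ℂ) {K : Set Circle}
    {V : Set C(K, ℂ)} (hV : IsOpen V)
    (hp : (⟨fun ζ => p.eval ((ζ : Circle) : ℂ), by fun_prop⟩ : C(K, ℂ)) ∈ V) :
    ∃ R : ℝ, R < 1 ∧ ∀ r : Set.Ico (0 : ℝ) 1, R < r →
      (dilation (polynomialHolDisc p) r).restrict K ∈ V := by
  let D : ℝ → C(K, ℂ) := fun r => ⟨fun ζ => p.eval ((r : ℂ) * ((ζ : Circle) : ℂ)), by fun_prop⟩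
  have hD : Continuous D := ContinuousMap.continuous_of_continuous_uncurry _ (by
    change Continuous fun a : ℝ × K => p.eval ((a.1 : ℂ) * ((a.2 : Circle) : ℂ))
    fun_prop)
  have h1 : D 1 ∈ V := by
    convert hp using 1
    ext ζ
    simp [D]
  obtain ⟨R, hR, hRV⟩ := exists_Ioc_subset_of_mem_nhds ((hV.preimage hD).mem_nhds h1)
    ⟨0, zero_lt_one⟩
  exact ⟨R, hR, fun r hr => hRV ⟨hr, r.2.2.le⟩⟩

/-- Weierstrass: locally uniform limits of holomorphic functions are holomorphic. Extension by zero
gives a canonical representative on `ℂ`. -/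
theorem isClosed_holDisc : IsClosed HolDisc := by
  classical
  let e : C(openDisc, ℂ) → ℂ → ℂ := fun g z => if h : z ∈ openDisc then g ⟨z, h⟩ else 0
  have he : ∀ g (z : openDisc), e g z = g z := fun g z => dif_pos z.2
  have hiff : ∀ g, g ∈ HolDisc ↔ DifferentiableOn ℂ (e g) openDisc := by
    refine fun g => ⟨?_, fun h => ⟨e g, h, fun z => (he g z).symm⟩⟩
    rintro ⟨F, hF, hg⟩
    exact hF.congr fun z hz => (he g ⟨z, hz⟩).trans (hg ⟨z, hz⟩)
  refine isClosed_of_closure_subset fun f hf => ?_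
  rw [hiff]
  have : (𝓝[HolDisc] f).NeBot := mem_closure_iff_nhdsWithin_neBot.1 hf
  have ht : Tendsto id (𝓝[HolDisc] f) (𝓝 f) := tendsto_id'.2 nhdsWithin_le_nhds
  have : LocallyCompactSpace openDisc := Metric.isOpen_ball.locallyCompactSpace
  rw [ContinuousMap.tendsto_iff_tendstoLocallyUniformly] at ht
  refine TendstoLocallyUniformlyOn.differentiableOn (F := e) (φ := 𝓝[HolDisc] f) ?_ ?_
    Metric.isOpen_ball
  · rw [tendstoLocallyUniformlyOn_iff_tendstoLocallyUniformly_comp_coe]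
    convert ht using 1
    · ext g z
      exact he g z
    · ext z
      exact he f z
  · filter_upwards [self_mem_nhdsWithin] with g hg using (hiff g).1 hg

instance : BaireSpace HolDisc := by
  have : LocallyCompactSpace openDisc := Metric.isOpen_ball.locallyCompactSpace
  have : CompleteSpace HolDisc := isClosed_holDisc.completeSpace_coe
  infer_instance

theorem exists_le_norm_le_of_isCompact {s : Set openDisc} (hs : IsCompact s) :
    ∃ ρ < 1, ∀ z ∈ s, ‖(z : ℂ)‖ ≤ ρ := by
  rcases s.eq_empty_or_nonempty with rfl | hne
  · exact ⟨0, zero_lt_one, by simp⟩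
  · obtain ⟨z, _, hz⟩ := hs.exists_isMaxOn hne
      (f := fun z : openDisc => ‖(z : ℂ)‖) (by fun_prop)
    exact ⟨_, mem_ball_zero_iff.1 z.2, fun w hw => hz hw⟩

theorem tendsto_holDisc_of_norm_sub_lt {ι : Type*} {l : Filter ι} {f : HolDisc} {g : ι → HolDisc}
    {ρ ε : ι → ℝ} (hρ : Tendsto ρ l (𝓝 1)) (hε : Tendsto ε l (𝓝 0))
    (h : ∀ i (z : openDisc), ‖(z : ℂ)‖ ≤ ρ i → ‖(g i).1 z - f.1 z‖ < ε i) :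
    Tendsto g l (𝓝 f) := by
  rw [tendsto_subtype_rng, ContinuousMap.tendsto_iff_forall_isCompact_tendstoUniformlyOn]
  intro s hs
  obtain ⟨R, hR1, hR⟩ := exists_le_norm_le_of_isCompact hs
  rw [Metric.tendstoUniformlyOn_iff]
  intro δ hδ
  filter_upwards [hρ.eventually (lt_mem_nhds hR1), hε.eventually (gt_mem_nhds hδ)] with i h1 h2 z hz
  rw [dist_comm, dist_eq_norm]
  exact (h i z ((hR z hz).trans h1.le)).trans h2

theorem continuous_dilation {Λ : Type*} [TopologicalSpace Λ] {r : Λ → Set.Ico (0 : ℝ) 1}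
    (hr : Continuous r) :
    Continuous fun a : HolDisc × Λ => dilation a.1 (r a.2) := by
  have : LocallyCompactSpace openDisc := Metric.isOpen_ball.locallyCompactSpace
  refine ContinuousMap.continuous_of_continuous_uncurry _ ?_
  change Continuous fun b : (HolDisc × Λ) × Circle => b.1.1.1 (radialPoint (r b.1.2) b.2)
  have h1 : Continuous fun b : (HolDisc × Λ) × Circle => radialPoint (r b.1.2) b.2 := by
    unfold radialPoint
    fun_prop
  exact ContinuousEval.continuous_eval.comp
    ((continuous_subtype_val.comp (continuous_fst.comp continuous_fst)).prodMk h1)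

/-! ### Openness and density of the basic conditions -/

section Universality

variable {Λ : Type*} [TopologicalSpace Λ] {ϱ : Λ → ℕ → Set.Ico (0 : ℝ) 1} {s : Set Λ}
  {K : Set Circle} {V : Set C(K, ℂ)}

/-- The functions for which, for each parameter in `s`, some dilation restricts into `V`. -/
def dilationHits (ϱ : Λ → ℕ → Set.Ico (0 : ℝ) 1) (s : Set Λ) (K : Set Circle)
    (V : Set C(K, ℂ)) : Set HolDisc :=
  {f | ∀ l ∈ s, ∃ n, (dilation f (ϱ l n)).restrict K ∈ V}

/-- For each `n` the condition is open jointly in `(f, l)`; the tube lemma over `s` applies although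
`n` may vary with `l`. -/
theorem isOpen_dilationHits (hcont : ∀ n, Continuous fun l => ϱ l n) (hs : IsCompact s)
    (hV : IsOpen V) : IsOpen (dilationHits ϱ s K V) := by
  rw [isOpen_iff_mem_nhds]
  intro f hf
  refine hs.eventually_forall_of_forall_eventually
    (P := fun f l => ∃ n, (dilation f (ϱ l n)).restrict K ∈ V) fun l hl => ?_
  obtain ⟨n, hn⟩ := hf l hl
  have hc : Continuous fun a : HolDisc × Λ => (dilation a.1 (ϱ a.2 n)).restrict K :=
    (ContinuousMap.continuous_restrict K).comp (continuous_dilation (hcont n))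
  filter_upwards [(hV.preimage hc).mem_nhds hn] with a ha using ⟨n, ha⟩

/-- As in Dini's theorem, monotonicity makes these open sets increase with `n`, so one of them
already covers `s`. -/
theorem exists_forall_lt_of_isCompact (hcont : ∀ n, Continuous fun l => ϱ l n)
    (hmono : ∀ l, Monotone (ϱ l))
    (hlim : ∀ l, Tendsto (fun n => (ϱ l n : ℝ)) atTop (𝓝 1)) (hs : IsCompact s)
    {R : ℝ} (hR : R < 1) : ∃ n, ∀ l ∈ s, R < ϱ l n := by
  refine hs.elim_directed_cover (fun n => {l | R < ϱ l n})
    (fun n => isOpen_lt continuous_const (continuous_subtype_val.comp (hcont n)))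
    (fun l _ => ?_) (Monotone.directed_le fun m n hmn l (hl : R < ϱ l m) => ?_)
  · exact Set.mem_iUnion.2 ((hlim l).eventually (lt_mem_nhds hR)).exists
  · exact lt_of_lt_of_le hl (hmono l hmn)

theorem dense_dilationHits (hcont : ∀ n, Continuous fun l => ϱ l n) (hmono : ∀ l, Monotone (ϱ l))
    (hlim : ∀ l, Tendsto (fun n => (ϱ l n : ℝ)) atTop (𝓝 1)) (hs : IsCompact s)
    (hK : IsCompact K) (hK' : K ≠ Set.univ) (hV : IsOpen V) (hVne : V.Nonempty) :
    Dense (dilationHits ϱ s K V) := by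
  intro f
  have : CompactSpace K := isCompact_iff_compactSpace.1 hK
  obtain ⟨F, hF, hfF⟩ := f.2
  -- The shift by `2` keeps the radius `1 - 1 / (k + 2)` strictly between `0` and `1` even at `k =
  -- 0`.
  have hlim0 : Tendsto (fun k : ℕ => 1 / ((k : ℝ) + 2)) atTop (𝓝 0) := by
    have := (tendsto_one_div_add_atTop_nhds_zero_nat (𝕜 := ℝ)).comp (tendsto_add_atTop_nat 1)
    refine this.congr fun k => ?_
    simp only [Function.comp_apply, Nat.cast_add, Nat.cast_one]
    ring
  have hpos : ∀ k : ℕ, 0 < 1 / ((k : ℝ) + 2) := fun k => by positivity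
  have hlt : ∀ k : ℕ, 1 / ((k : ℝ) + 2) < 1 := fun k =>
    (div_lt_one (by positivity)).2 (by have : (0 : ℝ) ≤ k := k.cast_nonneg; linarith)
  choose p hp hpV using fun k : ℕ => exists_polynomial_near hF (sub_pos.2 (hlt k))
    (sub_lt_self 1 (hpos k)) (hpos k) hK' hV hVne
  refine mem_closure_of_tendsto (b := atTop) (f := fun k => polynomialHolDisc (p k))
    (tendsto_holDisc_of_norm_sub_lt (ρ := fun k => 1 - 1 / ((k : ℝ) + 2)) (by simpa using tendsto_const_nhds.sub hlim0) hlim0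
      fun k z hz => ?_) (.of_forall fun k => ?_)
  · rw [hfF z]
    exact hp k z (mem_closedBall_zero_iff.2 hz)
  · obtain ⟨R, hR, hRV⟩ := exists_radius_dilation_polynomial_mem (p k) hV (hpV k)
    obtain ⟨n, hn⟩ := exists_forall_lt_of_isCompact hcont hmono hlim hs hR
    exact fun l hl => ⟨n, hRV _ (hn l hl)⟩

end Universality

/-! ### Reduction to countably many conditions -/

/-- By Tietze extension, restriction from `C(L, ℂ)` to `C(K, ℂ)` is surjective; being continuous, it
preserves dense range. -/
theorem DenseRange.restrict_of_subset {ι : Type*} {g : ι → C(Circle, ℂ)} {K L : Set Circle}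
    (hK : IsClosed K) (hKL : K ⊆ L) (hg : DenseRange fun i => (g i).restrict L) :
    DenseRange fun i => (g i).restrict K := by
  let res : C(L, ℂ) → C(K, ℂ) := fun h => h.comp ⟨Set.inclusion hKL, continuous_inclusion hKL⟩
  have hsurj : Function.Surjective res := fun φ => by
    obtain ⟨ψ, hψ⟩ := φ.exists_restrict_eq hK
    exact ⟨ψ.restrict L, by rw [← hψ]; rfl⟩
  exact hsurj.denseRange.comp hg (ContinuousMap.continuous_precomp _)

instance (U : TopologicalSpace.countableBasis Circle) :
    SecondCountableTopology C(((U : Set Circle)ᶜ : Set Circle), ℂ) := by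
  have : LocallyCompactSpace ((U : Set Circle)ᶜ : Set Circle) :=
    (TopologicalSpace.isOpen_of_mem_countableBasis U.2).isClosed_compl.locallyCompactSpace
  infer_instance

theorem mem_abelUniversal_iff {r : ℕ → Set.Ico (0 : ℝ) 1} {f : HolDisc} :
    f ∈ abelUniversal r ↔ ∀ (U : TopologicalSpace.countableBasis Circle),
      ∀ V ∈ TopologicalSpace.countableBasis C(((U : Set Circle)ᶜ : Set Circle), ℂ),
        ∃ n, (dilation f (r n)).restrict (U : Set Circle)ᶜ ∈ V := by
  constructor
  · intro hf U V hV
    obtain ⟨φ, hφ, n, rfl⟩ := (hf (U : Set Circle)ᶜ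
      (TopologicalSpace.isOpen_of_mem_countableBasis U.2).isClosed_compl.isCompact (by
        rw [Ne, Set.compl_univ_iff, ← Ne, ← Set.nonempty_iff_ne_empty]
        exact TopologicalSpace.nonempty_of_mem_countableBasis U.2)).inter_open_nonempty V
      (TopologicalSpace.isOpen_of_mem_countableBasis hV)
      (TopologicalSpace.nonempty_of_mem_countableBasis hV)
    exact ⟨n, hφ⟩
  · intro hf K hK hKne
    obtain ⟨c, hc⟩ := (Set.ne_univ_iff_exists_notMem K).1 hKne
    obtain ⟨U, hUK⟩ : ∃ U : TopologicalSpace.countableBasis Circle, (U : Set Circle) ⊆ Kᶜ := by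
      obtain ⟨U, hU, -, hUK⟩ := (TopologicalSpace.isBasis_countableBasis
        Circle).exists_subset_of_mem_open (Set.mem_compl hc) hK.isClosed.isOpen_compl
      exact ⟨⟨U, hU⟩, hUK⟩
    refine DenseRange.restrict_of_subset hK.isClosed (Set.subset_compl_comm.1 hUK)
      ((TopologicalSpace.isBasis_countableBasis _).dense_iff.2 fun V hV _ => ?_)
    obtain ⟨n, hn⟩ := hf U V hV
    exact ⟨_, hn, n, rfl⟩

theorem iInter_abelUniversal_eq {Λ : Type*} [TopologicalSpace Λ] [SigmaCompactSpace Λ]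
    (ϱ : Λ → ℕ → Set.Ico (0 : ℝ) 1) :
    ⋂ l, abelUniversal (ϱ l) =
      ⋂ a : ℕ × (Σ U : TopologicalSpace.countableBasis Circle,
          TopologicalSpace.countableBasis C(((U : Set Circle)ᶜ : Set Circle), ℂ)),
        dilationHits ϱ (compactCovering Λ a.1) (a.2.1 : Set Circle)ᶜ a.2.2 := by
  ext f
  simp only [Set.mem_iInter, mem_abelUniversal_iff]
  constructor
  · rintro h ⟨j, U, V⟩ l -
    exact h l U V V.2
  · intro h l U V hV
    obtain ⟨j, hj⟩ := exists_mem_compactCovering l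
    exact h (j, ⟨U, ⟨V, hV⟩⟩) l hj

theorem proposition6p8 (Λ : Set ℝ) (hΛ : IsSigmaCompact Λ)
    (ϱ : Λ → ℕ → Set.Ico (0 : ℝ) 1)
    (hmono : ∀ l : Λ, Monotone (ϱ l))
    (hlim : ∀ l : Λ, Filter.Tendsto (fun n : ℕ => (ϱ l n : ℝ)) Filter.atTop (nhds 1))
    (hcont : ∀ n : ℕ, Continuous fun l : Λ => (ϱ l n : ℝ)) :
    IsGδ (⋂ l : Λ, abelUniversal (ϱ l)) ∧ Dense (⋂ l : Λ, abelUniversal (ϱ l)) := by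
  have : SigmaCompactSpace Λ := isSigmaCompact_iff_sigmaCompactSpace.1 hΛ
  have hcont' : ∀ n, Continuous fun l => ϱ l n := fun n => continuous_induced_rng.2 (hcont n)
  have hopen : ∀ a : ℕ × (Σ U : TopologicalSpace.countableBasis Circle,
      TopologicalSpace.countableBasis C(((U : Set Circle)ᶜ : Set Circle), ℂ)),
      IsOpen (dilationHits ϱ (compactCovering Λ a.1) (a.2.1 : Set Circle)ᶜ a.2.2) := fun a =>
    isOpen_dilationHits hcont' (isCompact_compactCovering Λ a.1)
      (TopologicalSpace.isOpen_of_mem_countableBasis a.2.2.2)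
  have (U : TopologicalSpace.countableBasis Circle) :
      Countable (TopologicalSpace.countableBasis C(((U : Set Circle)ᶜ : Set Circle), ℂ)) :=
    (TopologicalSpace.countable_countableBasis _).to_subtype
  have : Countable (TopologicalSpace.countableBasis Circle) :=
    (TopologicalSpace.countable_countableBasis _).to_subtype
  rw [iInter_abelUniversal_eq]
  refine ⟨.iInter_of_isOpen hopen, dense_iInter_of_isOpen hopen fun a => ?_⟩
  refine dense_dilationHits hcont' hmono hlim (isCompact_compactCovering Λ a.1)
    (TopologicalSpace.isOpen_of_mem_countableBasis a.2.1.2).isClosed_compl.isCompact ?_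
    (TopologicalSpace.isOpen_of_mem_countableBasis a.2.2.2)
    (TopologicalSpace.nonempty_of_mem_countableBasis a.2.2.2)
  rw [Ne, Set.compl_univ_iff, ← Ne, ← Set.nonempty_iff_ne_empty]
  exact TopologicalSpace.nonempty_of_mem_countableBasis a.2.1.2
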